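/- For $c\in\mathbb{R}$, $1\le p\le\infty$ and $f:\mathbb{R}^+\to\mathbb{C}$ put $\|f\|_{X^p_c}:=\left(\int_0^\infty |x^c f(x)|^p\,\frac{dx}{x}\right)^{1/p}$ if $p<\infty$ and $\|f\|_{X^\infty_c}:=\sup_{x>0}|x^c f(x)|$ (values in $[0,\infty]$). For $\sigma>0$ let $B^\infty_{c,\sigma}$ be the space of all continuous functions $f:\mathbb{R}^+\to\mathbb{C}$ with $\|f\|_{X^\infty_c}<\infty$ that are Mellin band-limited to $[-\sigma,\sigma]$, that is, whose Mellin transform $t\mapsto [f]^\wedge_{M_c}(c+it)=\int_0^\infty f(u)u^{c+it-1}\,du$, understood as a distribution in $t$, vanishes on $\{|t|>\sigma\}$: $$\int_0^\infty f(u)\,u^{c-1}\left(\int_{\mathbb{R}}\varphi(t)\,u^{it}\,dt\right)du=0\quad\text{for all }\varphi\in C_c^\infty(\mathbb{R},\mathbb{C})\text{ with }\operatorname{supp}\varphi\subset\{|t|>\sigma\}.$$ Let $\Theta_c f(x):=\lim_{h\to1}\dfrac{h^c f(hx)-f(x)}{h-1}$ ($x>0$) denote the Mellin derivative. Theorem.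 Let $c\in\mathbb{R}$, $T>0$ and $f\in B^\infty_{c,\pi T}$. Then for every $x>0$ the Mellin derivative $\Theta_c f(x)$ exists, the following series converges absolutely, and $$\Theta_c f(x)=\frac{4T}{\pi}\sum_{k\in\mathbb{Z}}\frac{(-1)^{k+1}}{(2k-1)^2}\,e^{(k-1/2)c/T}\,f\!\left(x\,e^{(k-1/2)/T}\right).$$ Consequently, for every $p\in[1,\infty]$, $\|\Theta_c f\|_{X^p_c}\le \pi T\,\|f\|_{X^p_c}$. -/

import Mathlib

open MeasureTheory Set Filter Topology
open scoped ENNReal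

/-! Functions on `ℝ⁺ = (0, ∞)` are represented by functions `ℝ → ℂ`; every notion below
only uses their values on `(0, ∞)`. -/

noncomputable section

/-- The invariant measure `dx / x` on `(0, ∞)`. -/
def mellinMeasure : Measure ℝ :=
  (volume.restrict (Ioi (0 : ℝ))).withDensity fun x => ENNReal.ofReal x⁻¹

/-- The norm of the space `X^p_c`, with value `∞` outside of the space:
the `L^p (dx / x)` norm of `x ^ c * f x` if `p < ∞`,
and the supremum of `|x ^ c * f x|` over `x > 0` if `p = ∞`. -/
def mellinNorm (c : ℝ) (p : ℝ≥0∞) (f : ℝ → ℂ) : ℝ≥0∞ :=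
  if p = ∞ then ⨆ x ∈ Ioi (0 : ℝ), ‖((x ^ c : ℝ) : ℂ) * f x‖ₑ
  else eLpNorm (fun x : ℝ => ((x ^ c : ℝ) : ℂ) * f x) p mellinMeasure

/-- The Mellin transform `t ↦ [f]^∧ (c + i t)` of `f`, taken in the sense of distributions in `t`,
vanishes for `|t| > σ`. Its pairing with a test function `φ` is
`∫ u in (0, ∞), f u * u ^ (c - 1) * (∫ t, φ t * u ^ (i t))`, which for `f ∈ X^1_c` equals
`∫ t, [f]^∧ (c + i t) * φ t` by Fubini's theorem. -/
def IsMellinBandLimited (c σ : ℝ) (f : ℝ → ℂ) : Prop :=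
  ∀ φ : ℝ → ℂ, ContDiff ℝ (⊤ : ℕ∞) φ → HasCompactSupport φ → (∀ t ∈ tsupport φ, σ < |t|) →
    (∫ u in Ioi (0 : ℝ),
      f u * ((u ^ (c - 1) : ℝ) : ℂ) * (∫ t : ℝ, φ t * (u : ℂ) ^ ((t : ℂ) * Complex.I))) = 0

/-- The Mellin-Bernstein space `B^p_{c,σ}`: continuous functions of `X^p_c` that are
Mellin band-limited to `[-σ, σ]`. -/
def MellinBernstein (c : ℝ) (p : ℝ≥0∞) (σ : ℝ) : Set (ℝ → ℂ) :=
  {f | ContinuousOn f (Ioi 0) ∧ mellinNorm c p f < ∞ ∧ IsMellinBandLimited c σ f}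

/-- The difference quotient `(h ^ c * f (h * x) - f x) / (h - 1)`. -/
def mellinQuotient (c : ℝ) (f : ℝ → ℂ) (x h : ℝ) : ℂ :=
  (((h ^ c : ℝ) : ℂ) * f (h * x) - f x) / ((h : ℂ) - 1)

/-- The Mellin derivative of `f` at `x` exists and equals `a`. -/
def HasMellinDerivAt (c : ℝ) (f : ℝ → ℂ) (a : ℂ) (x : ℝ) : Prop :=
  Tendsto (mellinQuotient c f x) (𝓝[≠] 1) (𝓝 a)

/-- The Mellin derivative `Θ_c f`. -/
def mellinDeriv (c : ℝ) (f : ℝ → ℂ) (x : ℝ) : ℂ :=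
  limUnder (𝓝[≠] (1 : ℝ)) (mellinQuotient c f x)

/-- The `k`-th term of the Boas-type series at `x`, without the factor `4 T / π`. -/
def mellinBoasTerm (c T : ℝ) (f : ℝ → ℂ) (x : ℝ) (k : ℤ) : ℂ :=
  (-1) ^ (k + 1) / (2 * (k : ℂ) - 1) ^ 2
    * ((Real.exp (((k : ℝ) - 1 / 2) * c / T) : ℝ) : ℂ)
    * f (x * Real.exp (((k : ℝ) - 1 / 2) / T))

end

/-! In the variable `x = exp (2πs)` the weighted function `x ^ c * f x` becomes a bounded continuous
`g` whose distributional Fourier transform lives in `[-Ω, Ω]`, `Ω = πT`, and the Mellin derivative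
becomes `g' / (2π)`. The claim is then Boas' formula for `g'`: on the Fourier side, differentiation
multiplies by a linear function of the frequency, and on `[-Ω, Ω]` this function agrees with a
triangle wave, whose absolutely convergent Fourier series (`hasSum_boasCoeff_mul_exp`) is a sum of
characters, i.e. of translations.

Since `g` has only a distributional spectrum, the identity is proved on a kernel: for `W > Ω` a
Schwartz `K` with Fourier support in `[-W, W]` reproduces `g` (`HasSpectrumIn.exists_kernel`) and
satisfies the formula itself (`hasSum_boas_schwartz`). Differentiating and summing under the
integral transfers it to `g`, and `W ↓ Ω` gives the sharp step (`HasSpectrumIn.hasDerivAt`).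

The norm bound is the triangle inequality: the dilations `x ↦ x * exp t` preserve `dx / x`, and the
coefficients have absolute sum `(4T/π)(π²/4) = πT`. -/

/-! ### Fourier series of the triangle wave -/

theorem hasSum_int_odd {f : ℤ → ℂ} {a b : ℂ} (hf : HasSum f a)
    (he : HasSum (fun k : ℤ => f (2 * k)) b) : HasSum (fun k : ℤ => f (2 * k - 1)) (a - b) := by
  have hi : Function.Injective (fun k : ℤ => 2 * k) := fun a b h => by simpa using h
  have hj : Function.Injective (fun k : ℤ => 2 * k - 1) := fun a b h => by simpa using h
  have ho := (hf.summable.comp_injective hj).hasSum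
  have hc : IsCompl (range fun k : ℤ => 2 * k) (range fun k : ℤ => 2 * k - 1) := by
    rw [isCompl_iff, disjoint_iff_inter_eq_empty, codisjoint_iff_le_sup]
    refine ⟨?_, ?_⟩
    · ext n
      simp only [mem_inter_iff, mem_range, mem_empty_iff_false, iff_false, not_and]
      rintro ⟨k, rfl⟩ ⟨l, hl⟩
      omega
    · intro n _
      rcases Int.even_or_odd' n with ⟨k, rfl | rfl⟩
      · exact Or.inl ⟨k, rfl⟩
      · exact Or.inr ⟨k + 1, by ring⟩
  have h := HasSum.add_isCompl hc (hi.hasSum_range_iff.2 he) (hj.hasSum_range_iff.2 ho)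
  have e := hf.unique h
  convert! ho using 1
  rw [e]; ring

/-- The even part of the Fourier series of the Bernoulli polynomial `B₂` at `x` is a quarter of the
series at `2x`; in `B₂(x) - B₂(2x)/4` the quadratic terms cancel. The restriction to `[0, 1/2]`
keeps `2x` in `[0, 1]`. -/
theorem hasSum_odd_fourier {x : ℝ} (hx : x ∈ Icc (0 : ℝ) (1 / 2)) :
    HasSum (fun k : ℤ => 1 / (2 * (k : ℂ) - 1) ^ 2 *
      Complex.exp (2 * Real.pi * Complex.I * (2 * k - 1) * x))
      ((Real.pi : ℂ) ^ 2 * (1 / 4 - x)) := by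
  have h1 := hasSum_one_div_pow_mul_fourier_mul_bernoulliFun (k := 2) le_rfl (x := x)
    ⟨hx.1, by linarith [hx.2]⟩
  have h2 := hasSum_one_div_pow_mul_fourier_mul_bernoulliFun (k := 2) le_rfl (x := 2 * x)
    ⟨by linarith [hx.1], by linarith [hx.2]⟩
  simp only [fourier_coe_apply, bernoulliFun_two] at h1 h2
  have h := hasSum_int_odd h1 (b := 1 / 4 * (-(2 * Real.pi * Complex.I) ^ 2 / (Nat.factorial 2) *
      (((2 * x) ^ 2 - 2 * x + 6⁻¹ : ℝ) : ℂ))) (by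
    convert! h2.mul_left (1 / 4) using 2 with k
    rw [← mul_assoc]
    congr 1
    · push_cast
      rw [mul_pow]
      -- The term `k = 0` is harmless because `1 / 0 = 0`.
      by_cases hk : (k : ℂ) = 0
      · simp [hk]
      · field_simp
        norm_num
    · congr 1
      push_cast
      ring)
  convert! h using 1
  · ext k
    push_cast
    congr 2
    ring
  · push_cast
    simp only [mul_pow, Complex.I_sq, Nat.factorial]
    push_cast
    ring

/-- The coefficients of the Boas series. -/
noncomputable def boasCoeff (k : ℤ) : ℂ := (-1) ^ (k + 1) / (2 * (k : ℂ) - 1) ^ 2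

theorem norm_boasCoeff (k : ℤ) : ‖boasCoeff k‖ = 1 / (2 * (k : ℝ) - 1) ^ 2 := by
  have : (2 * (k : ℂ) - 1) = ((2 * (k : ℝ) - 1 : ℝ) : ℂ) := by push_cast; ring
  rw [boasCoeff, norm_div, norm_zpow, norm_neg, norm_one, one_zpow, norm_pow, this,
    Complex.norm_real, Real.norm_eq_abs, sq_abs]

/-- The odd series at `x = 0`; its value yields the constant `πT` in the norm bound. -/
theorem hasSum_norm_boasCoeff : HasSum (fun k => ‖boasCoeff k‖) (Real.pi ^ 2 / 4) := by
  have h := hasSum_odd_fourier (x := 0) ⟨le_rfl, by norm_num⟩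
  rw [← Complex.hasSum_ofReal]
  convert! h using 1
  · ext k
    rw [norm_boasCoeff]
    push_cast
    simp
  · push_cast
    ring

theorem summable_norm_boasCoeff : Summable fun k => ‖boasCoeff k‖ := hasSum_norm_boasCoeff.summable

/-- The Fourier series of the triangle wave, on the interval where the wave is linear. -/
theorem hasSum_boasCoeff_mul_exp {y : ℝ} (hy : |y| ≤ 1 / 4) :
    HasSum (fun k : ℤ => boasCoeff k * Complex.exp (2 * Real.pi * Complex.I * (2 * k - 1) * y))
      (Complex.I * Real.pi ^ 2 * y) := by
  rw [abs_le] at hy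
  -- A quarter-period shift centres the linear piece at `0` and produces the signs `(-1) ^ (k + 1)`,
  -- up to the factor `I`.
  have h := (hasSum_odd_fourier (x := 1 / 4 + y) ⟨by linarith, by linarith⟩).mul_left (-Complex.I)
  convert! h using 1
  · ext k
    have e : Complex.exp (2 * Real.pi * Complex.I * (2 * k - 1) * ((1 / 4 + y : ℝ) : ℂ)) =
        Complex.I * (-1) ^ (k + 1) * Complex.exp (2 * Real.pi * Complex.I * (2 * k - 1) * y) := by
      have : 2 * Real.pi * Complex.I * (2 * k - 1) * ((1 / 4 + y : ℝ) : ℂ) =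
          Real.pi / 2 * Complex.I + ((k - 1 : ℤ) : ℂ) * (Real.pi * Complex.I) +
          2 * Real.pi * Complex.I * (2 * k - 1) * y := by
        push_cast; ring
      rw [this, Complex.exp_add, Complex.exp_add, Complex.exp_pi_div_two_mul_I,
        Complex.exp_int_mul, Complex.exp_pi_mul_I]
      congr 2
      rw [show k + 1 = k - 1 + 2 by ring, zpow_add₀ (by norm_num)]
      norm_num
    rw [e, boasCoeff]
    linear_combination ((-1) ^ (k + 1) / (2 * (k : ℂ) - 1) ^ 2 *
      Complex.exp (2 * Real.pi * Complex.I * (2 * k - 1) * y)) * Complex.I_sq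
  · push_cast; ring

/-! ### Boas' formula for bounded band-limited functions on the line -/

section BandLimited

open scoped SchwartzMap FourierTransform ContDiff

/-- The distributional Fourier transform of `g` vanishes outside of `[-Ω, Ω]`. -/
def HasSpectrumIn (Ω : ℝ) (g : ℝ → ℂ) : Prop :=
  ∀ φ : ℝ → ℂ, ContDiff ℝ ∞ φ → HasCompactSupport φ → (∀ t ∈ tsupport φ, Ω < |t|) →
    ∫ s, g s * (∫ t : ℝ, φ t * Complex.exp (2 * Real.pi * Complex.I * s * t)) = 0

theorem schwartz_fourierInv_apply (χ : 𝓢(ℝ, ℂ)) (z : ℝ) :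
    (𝓕⁻ χ) z = ∫ t : ℝ, χ t * Complex.exp (2 * Real.pi * Complex.I * z * t) := by
  rw [SchwartzMap.fourierInv_coe, Real.fourierInv_eq']
  refine integral_congr_ae (ae_of_all _ fun t => ?_)
  simp only [smul_eq_mul, RCLike.inner_apply, conj_trivial]
  rw [mul_comm]
  congr 2
  push_cast
  ring

theorem norm_cexp_two_pi_I_mul (s t : ℝ) :
    ‖Complex.exp (2 * Real.pi * Complex.I * s * t)‖ = 1 := by
  rw [show 2 * Real.pi * Complex.I * s * t = ((2 * Real.pi * s * t : ℝ) : ℂ) * Complex.I by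
    push_cast; ring]
  exact Complex.norm_exp_ofReal_mul_I _

theorem integrable_mul_cexp {χ : ℝ → ℂ} (hχ : Integrable χ) (z : ℝ) :
    Integrable fun t : ℝ => χ t * Complex.exp (2 * Real.pi * Complex.I * z * t) := by
  refine hχ.mul_bdd (c := 1) (by fun_prop) (ae_of_all _ fun t => ?_)
  rw [norm_cexp_two_pi_I_mul]

theorem integrable_bdd_mul {g K : ℝ → ℂ} {M : ℝ} (hg : Continuous g) (hM : ∀ s, ‖g s‖ ≤ M)
    (hK : Integrable K) : Integrable fun y => g y * K y :=
  hK.bdd_mul hg.aestronglyMeasurable (ae_of_all _ hM)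

theorem integral_schwartz_comp_mul_cexp (χ : 𝓢(ℝ, ℂ)) {l : ℝ} (hl : 0 < l) (z : ℝ) :
    ∫ t : ℝ, χ (l * t) * Complex.exp (2 * Real.pi * Complex.I * z * t) =
      (l⁻¹ : ℝ) * (𝓕⁻ χ) (l⁻¹ * z) := by
  have h := Measure.integral_comp_mul_left
    (fun t : ℝ => χ t * Complex.exp (2 * Real.pi * Complex.I * (l⁻¹ * z : ℝ) * t)) l
  rw [schwartz_fourierInv_apply, ← Complex.real_smul, ← abs_of_pos (inv_pos.2 hl), abs_abs] at *
  rw [abs_of_pos (inv_pos.2 hl)] at *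
  rw [← h]
  refine integral_congr_ae (ae_of_all _ fun t => ?_)
  simp only
  congr 2
  push_cast
  have : (l : ℂ) ≠ 0 := by exact_mod_cast hl.ne'
  field_simp

theorem integral_mul_dilated {g K : ℝ → ℂ} {l : ℝ} (hl : 0 < l) (s : ℝ) :
    ∫ y, g y * ((l⁻¹ : ℝ) * K (l⁻¹ * (y - s))) = ∫ z, g (s + l * z) * K z := by
  have h := Measure.integral_comp_mul_left (fun z => g (s + l * z) * K z) l⁻¹
  rw [inv_inv, abs_of_pos hl] at h
  have h2 := integral_sub_right_eq_self (μ := volume)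
    (fun y => g (s + l * (l⁻¹ * y)) * K (l⁻¹ * y)) s
  have h3 : ∫ z, g (s + l * z) * K z = l⁻¹ • (l • ∫ z, g (s + l * z) * K z) := by
    rw [smul_smul, inv_mul_cancel₀ hl.ne', one_smul]
  rw [h3, ← h, ← h2, ← integral_smul]
  refine integral_congr_ae (ae_of_all _ fun y => ?_)
  simp only [Complex.real_smul]
  rw [← mul_assoc l, mul_inv_cancel₀ hl.ne', one_mul, add_sub_cancel]
  ring

/-- Pairing with a smooth kernel does not change under dilations of its Fourier transform,
as long as the latter stays equal to `1` around the spectrum. -/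
theorem HasSpectrumIn.integral_eq_dilated {Ω r M l : ℝ} {g : ℝ → ℂ} (hgc : Continuous g)
    (hM : ∀ s, ‖g s‖ ≤ M) (hg : HasSpectrumIn Ω g) {χ : 𝓢(ℝ, ℂ)} (hχ : HasCompactSupport χ)
    (hr : Ω < r) (hχr : ∀ t, |t| ≤ r → χ t = 1) (hl : 0 < l) (hl1 : l ≤ 1) (s : ℝ) :
    ∫ y, g y * (𝓕⁻ χ) (y - s) = ∫ z, g (s + l * z) * (𝓕⁻ χ) z := by
  have hK : Integrable (𝓕⁻ χ : 𝓢(ℝ, ℂ)) := (𝓕⁻ χ).integrable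
  have hχl : HasCompactSupport fun t => χ (l * t) :=
    hχ.comp_homeomorph (Homeomorph.mulLeft₀ l hl.ne')
  -- Both bumps equal `1` on `[-r, r]`, so their difference is supported off the spectrum; the
  -- exponential translates the kernel by `s`.
  let φ : ℝ → ℂ := fun t => (χ t - χ (l * t)) * Complex.exp (2 * Real.pi * Complex.I * (-s : ℝ) * t)
  have h0 := hg φ
    (by
      have h1 := χ.smooth ⊤
      have h2 : ContDiff ℝ ∞ fun t : ℝ => Complex.exp (2 * Real.pi * Complex.I * (-s : ℝ) * t) :=
        (contDiff_const.mul Complex.ofRealCLM.contDiff).cexp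
      exact (h1.sub (h1.comp (contDiff_const.mul contDiff_id))).mul h2)
    (HasCompactSupport.mul_right (hχ.sub hχl))
    (by
      intro t ht
      have hsub : tsupport φ ⊆ {t | r ≤ |t|} := by
        refine closure_minimal ?_ (isClosed_le continuous_const continuous_abs)
        intro t ht
        by_contra h
        simp only [mem_ofPred_eq, not_le] at h
        apply ht
        have : |l * t| ≤ r := by
          rw [abs_mul, abs_of_pos hl]
          nlinarith [abs_nonneg t]
        simp only [φ, hχr t h.le, hχr _ this, sub_self, zero_mul]
      exact hr.trans_le (hsub ht))
  have h1 : ∀ y : ℝ, ∫ t : ℝ, φ t * Complex.exp (2 * Real.pi * Complex.I * y * t) =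
      (𝓕⁻ χ) (y - s) - (l⁻¹ : ℝ) * (𝓕⁻ χ) (l⁻¹ * (y - s)) := by
    intro y
    rw [← integral_schwartz_comp_mul_cexp χ hl, schwartz_fourierInv_apply, ← integral_sub
      (integrable_mul_cexp χ.integrable _)
      (integrable_mul_cexp (χ.integrable.comp_mul_left' hl.ne') _)]
    refine integral_congr_ae (ae_of_all _ fun t => ?_)
    simp only [φ]
    rw [mul_assoc, ← Complex.exp_add, ← sub_mul]
    congr 2
    push_cast
    ring
  simp_rw [h1, mul_sub (g _)] at h0
  rw [integral_sub] at h0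
  · rw [sub_eq_zero.1 h0, integral_mul_dilated hl]
  · exact integrable_bdd_mul hgc hM (hK.comp_sub_right s)
  · exact integrable_bdd_mul hgc hM
      (((hK.comp_mul_left' (inv_ne_zero hl.ne')).comp_sub_right s).const_mul _)

theorem integral_schwartz_fourierInv (χ : 𝓢(ℝ, ℂ)) : ∫ z, (𝓕⁻ χ) z = χ 0 := by
  have h : (𝓕 (𝓕⁻ χ)) (0 : ℝ) = χ 0 := by rw [FourierTransform.fourier_fourierInv_eq]
  rw [← h, SchwartzMap.fourier_coe, Real.fourier_eq']
  simp

/-- The integral is unchanged when the kernel is concentrated at `s` by dilations `l = 1 / (n + 1) →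
0`; in the limit only `g s` times the total mass `χ 0 = 1` remains. -/
theorem HasSpectrumIn.integral_mul_fourierInv {Ω r M : ℝ} {g : ℝ → ℂ} (hgc : Continuous g)
    (hM : ∀ s, ‖g s‖ ≤ M) (hg : HasSpectrumIn Ω g) {χ : 𝓢(ℝ, ℂ)} (hχ : HasCompactSupport χ)
    (hr : Ω < r) (hr0 : 0 ≤ r) (hχr : ∀ t, |t| ≤ r → χ t = 1) (s : ℝ) :
    ∫ y, g y * (𝓕⁻ χ) (y - s) = g s := by
  have hK : Integrable (𝓕⁻ χ : 𝓢(ℝ, ℂ)) := (𝓕⁻ χ).integrable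
  have hlim : Tendsto (fun n : ℕ => ∫ z, g (s + 1 / ((n : ℝ) + 1) * z) * (𝓕⁻ χ) z) atTop
      (𝓝 (∫ z, g s * (𝓕⁻ χ) z)) := by
    refine tendsto_integral_of_dominated_convergence (fun z => M * ‖(𝓕⁻ χ) z‖) (fun n => ?_)
      (hK.norm.const_mul M) (fun n => ae_of_all _ fun z => ?_) (ae_of_all _ fun z => ?_)
    · exact ((hgc.comp (by fun_prop)).mul (𝓕⁻ χ).continuous).aestronglyMeasurable
    · rw [norm_mul]
      exact mul_le_mul_of_nonneg_right (hM _) (norm_nonneg _)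
    · refine Tendsto.mul_const _ ((hgc.tendsto s).comp ?_)
      simpa using (tendsto_one_div_add_atTop_nhds_zero_nat (𝕜 := ℝ)).mul_const z |>.const_add s
  rw [integral_const_mul, integral_schwartz_fourierInv, hχr 0 (by simpa using hr0), mul_one] at hlim
  refine tendsto_nhds_unique (tendsto_const_nhds.congr fun n => ?_) hlim
  refine hg.integral_eq_dilated hgc hM hχ hr hχr (by positivity) ?_ s
  rw [div_le_one (by positivity)]
  linarith [n.cast_nonneg (α := ℝ)]

theorem hasDerivAt_schwartz_fourierInv {χ : 𝓢(ℝ, ℂ)} (hχ : HasCompactSupport χ) (z : ℝ) :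
    HasDerivAt (𝓕⁻ χ : 𝓢(ℝ, ℂ))
      (∫ t : ℝ, 2 * Real.pi * Complex.I * t *
        (χ t * Complex.exp (2 * Real.pi * Complex.I * z * t))) z := by
  have hi : Integrable fun t : ℝ => t • χ t :=
    (continuous_id.smul χ.continuous).integrable_of_hasCompactSupport hχ.smul_left
  have h := (Real.hasDerivAt_fourier χ.integrable hi (-z)).scomp z (hasDerivAt_neg z)
  have e : ((𝓕⁻ χ : 𝓢(ℝ, ℂ)) : ℝ → ℂ) = 𝓕 (χ : ℝ → ℂ) ∘ Neg.neg := by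
    ext y
    rw [SchwartzMap.fourierInv_coe, Real.fourierInv_eq_fourier_neg]
    rfl
  rw [e]
  convert! h using 1
  rw [Real.fourier_eq', neg_smul, one_smul, ← integral_neg]
  refine integral_congr_ae (ae_of_all _ fun t => ?_)
  simp only [smul_eq_mul, RCLike.inner_apply, conj_trivial]
  rw [show (((-2 * Real.pi * (-z * t) : ℝ) : ℂ) * Complex.I) = 2 * Real.pi * Complex.I * z * t by
    push_cast; ring]
  ring

theorem summable_boasCoeff_mul {u : ℤ → ℂ} {M : ℝ} (hu : ∀ k, ‖u k‖ ≤ M) :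
    Summable fun k => boasCoeff k * u k := by
  refine Summable.of_norm_bounded (summable_norm_boasCoeff.mul_right M) fun k => ?_
  rw [norm_mul]
  exact mul_le_mul_of_nonneg_left (hu k) (norm_nonneg _)

/-- The Boas formula for the derivative of a band-limited Schwartz function. -/
theorem hasSum_boas_schwartz {χ : 𝓢(ℝ, ℂ)} {W : ℝ} (hW : 0 < W) (hχ : HasCompactSupport χ)
    (hχW : ∀ t, W < |t| → χ t = 0) (z : ℝ) :
    HasSum (fun k : ℤ => boasCoeff k * (𝓕⁻ χ) (z - ((k : ℝ) - 1 / 2) / (2 * W)))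
      (-(Real.pi / (8 * W)) * deriv (𝓕⁻ χ : 𝓢(ℝ, ℂ)) z) := by
  have hW' : (W : ℂ) ≠ 0 := by exact_mod_cast hW.ne'
  let F : ℤ → ℝ → ℂ := fun k t => boasCoeff k *
    (χ t * Complex.exp (2 * Real.pi * Complex.I * (z - ((k : ℝ) - 1 / 2) / (2 * W) : ℝ) * t))
  have h := hasSum_integral_of_summable_integral_norm (μ := volume) (F := F)
    (fun k => (integrable_mul_cexp χ.integrable _).const_mul _) (by
      simp_rw [F, norm_mul, norm_cexp_two_pi_I_mul, mul_one, integral_const_mul]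
      exact summable_norm_boasCoeff.mul_right _)
  have hF : ∀ t, ∑' k, F k t = -(Real.pi / (8 * W)) * (2 * Real.pi * Complex.I * t *
        (χ t * Complex.exp (2 * Real.pi * Complex.I * z * t))) := by
    intro t
    by_cases ht : W < |t|
    · simp [F, hχW t ht]
    -- Translation by `(2k - 1) / (4W)` is multiplication by the character of frequency `2k - 1` at
    -- `y = -t / (4W)`, and `|t| ≤ W` is exactly the range where the wave is linear.
    · have hy : |-t / (4 * W)| ≤ 1 / 4 := by
        rw [abs_div, abs_neg, abs_of_pos (by positivity : 0 < 4 * W),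
          div_le_div_iff₀ (by positivity) (by norm_num)]
        linarith
      have hs := (hasSum_boasCoeff_mul_exp hy).mul_left
        (χ t * Complex.exp (2 * Real.pi * Complex.I * z * t))
      refine Eq.trans (HasSum.tsum_eq (a := χ t * Complex.exp (2 * Real.pi * Complex.I * z * t) *
          (Complex.I * Real.pi ^ 2 * (-t / (4 * W) : ℝ))) ?_) ?_
      · convert! hs using 1
        ext k
        simp only [F]
        rw [mul_assoc (χ t), mul_left_comm (Complex.exp _), ← Complex.exp_add,
          mul_left_comm (χ t)]
        congr 3
        push_cast
        field_simp
        ring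
      · push_cast
        field_simp
        ring
  simp_rw [hF] at h
  rw [integral_const_mul, ← (hasDerivAt_schwartz_fourierInv hχ z).deriv] at h
  convert! h using 1
  ext k
  rw [integral_const_mul, schwartz_fourierInv_apply]

theorem hasDerivAt_integral_mul_schwartz_sub {g : ℝ → ℂ} {M : ℝ} (hgc : Continuous g)
    (hM : ∀ s, ‖g s‖ ≤ M) (K : 𝓢(ℝ, ℂ)) (s : ℝ) :
    HasDerivAt (fun x => ∫ y, g y * K (y - x)) (∫ y, g y * -deriv K (y - s)) s := by
  obtain ⟨C, hC0, hC⟩ : ∃ C : ℝ, 0 ≤ C ∧ ∀ x, ‖deriv K x‖ ≤ C * (1 + ‖x‖) ^ (-2 : ℝ) := by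
    refine ⟨2 ^ 2 * (Finset.Iic (2, 1)).sup (fun m => SchwartzMap.seminorm ℝ m.1 m.2) K,
      by positivity, fun x => ?_⟩
    have h := SchwartzMap.one_add_le_sup_seminorm_apply (𝕜 := ℝ) (m := (2, 1)) (k := 2) (n := 1)
      le_rfl le_rfl K x
    rw [norm_iteratedFDeriv_eq_norm_iteratedDeriv, iteratedDeriv_one] at h
    rw [Real.rpow_neg (by positivity), ← div_eq_mul_inv, le_div_iff₀ (by positivity), mul_comm]
    exact_mod_cast h
  have hM0 : 0 ≤ M := (norm_nonneg _).trans (hM 0)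
  have hK' : Continuous (deriv K) := (SchwartzMap.derivCLM ℝ ℂ K).continuous
  refine (hasDerivAt_integral_of_dominated_loc_of_deriv_le (μ := volume)
    (F := fun x y => g y * K (y - x)) (F' := fun x y => g y * -deriv K (y - x))
    (bound := fun y => M * (C * 4 * (1 + ‖y - s‖) ^ (-2 : ℝ))) (Metric.ball_mem_nhds s one_pos)
    ?_ ?_ ?_ ?_ ?_ ?_).2
  · exact Eventually.of_forall fun x =>
      (hgc.mul (K.continuous.comp (by fun_prop))).aestronglyMeasurable
  · exact integrable_bdd_mul hgc hM (K.integrable.comp_sub_right s)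
  · exact (hgc.mul (hK'.comp (by fun_prop)).neg).aestronglyMeasurable
  · refine ae_of_all _ fun y x hx => ?_
    rw [norm_mul, norm_neg]
    refine mul_le_mul (hM y) ((hC _).trans ?_) (norm_nonneg _) hM0
    rw [mul_assoc]
    refine mul_le_mul_of_nonneg_left ?_ hC0
    -- Moving the centre by less than `1` costs a factor `2`, hence the `4` in the dominating
    -- function.
    have h1 : 1 + ‖y - s‖ ≤ 2 * (1 + ‖y - x‖) := by
      have h2 : ‖y - s‖ ≤ ‖y - x‖ + ‖x - s‖ := norm_sub_le_norm_sub_add_norm_sub _ _ _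
      have h3 : ‖x - s‖ < 1 := by simpa [dist_eq_norm] using hx
      linarith [norm_nonneg (y - x)]
    rw [Real.rpow_neg (by positivity), Real.rpow_neg (by positivity), ← div_eq_mul_inv,
      inv_eq_one_div, div_le_div_iff₀ (by positivity) (by positivity)]
    norm_cast
    nlinarith [norm_nonneg (y - s), norm_nonneg (y - x)]
  · exact (((integrable_one_add_norm (by simp)).comp_sub_right s).const_mul _).const_mul _
  · refine ae_of_all _ fun y x _ => HasDerivAt.const_mul _ ?_
    have h := (K.differentiableAt (x := y - x)).hasDerivAt.scomp x ((hasDerivAt_id x).const_sub y)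
    rwa [neg_smul, one_smul] at h

theorem exists_schwartz_bump {r R : ℝ} (hr : 0 < r) (hR : r < R) :
    ∃ χ : 𝓢(ℝ, ℂ), HasCompactSupport χ ∧ (∀ t, |t| ≤ r → χ t = 1) ∧ ∀ t, R < |t| → χ t = 0 := by
  obtain ⟨b, hb⟩ : ∃ b : ContDiffBump (0 : ℝ), b.rIn = r ∧ b.rOut = R := ⟨⟨r, R, hr, hR⟩, rfl, rfl⟩
  have hbc : HasCompactSupport fun t => (b t : ℂ) :=
    b.hasCompactSupport.comp_left (g := Complex.ofReal) Complex.ofReal_zero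
  have hbs : ContDiff ℝ ∞ fun t => (b t : ℂ) := Complex.ofRealCLM.contDiff.comp b.contDiff
  refine ⟨hbc.toSchwartzMap hbs, hbc, fun t ht => ?_, fun t ht => ?_⟩
  · change (b t : ℂ) = 1
    rw [b.one_of_mem_closedBall (by simpa [hb.1] using ht), Complex.ofReal_one]
  · change (b t : ℂ) = 0
    rw [b.zero_of_le_dist (by simpa [hb.2] using ht.le), Complex.ofReal_zero]

/-- A reproducing kernel for functions with spectrum in `[-Ω, Ω]` that satisfies the Boas formula. -/
theorem HasSpectrumIn.exists_kernel {Ω W M : ℝ} {g : ℝ → ℂ} (hgc : Continuous g)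
    (hM : ∀ s, ‖g s‖ ≤ M) (hg : HasSpectrumIn Ω g) (hΩ : 0 < Ω) (hW : Ω < W) :
    ∃ K : 𝓢(ℝ, ℂ), (∀ s, ∫ y, g y * K (y - s) = g s) ∧
      ∀ z, HasSum (fun k : ℤ => boasCoeff k * K (z - ((k : ℝ) - 1 / 2) / (2 * W)))
        (-(Real.pi / (8 * W)) * deriv K z) := by
  -- The midpoint leaves room on both sides: `χ` is `1` beyond the spectrum and vanishes past `W`.
  obtain ⟨χ, hχ, hχ1, hχ0⟩ := exists_schwartz_bump (r := (Ω + W) / 2) (R := W) (by linarith)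
    (by linarith)
  exact ⟨𝓕⁻ χ, hg.integral_mul_fourierInv hgc hM hχ (by linarith) (by linarith) hχ1,
    hasSum_boas_schwartz (hΩ.trans hW) hχ hχ0⟩

theorem hasSum_integral_mul_translates {g : ℝ → ℂ} {M : ℝ} (hgc : Continuous g)
    (hM : ∀ s, ‖g s‖ ≤ M) {K : ℝ → ℂ} (hK : Integrable K) (τ : ℤ → ℝ) :
    HasSum (fun k : ℤ => boasCoeff k * ∫ y, g y * K (y - τ k))
      (∫ y, ∑' k : ℤ, boasCoeff k * (g y * K (y - τ k))) := by
  have hi := fun t => integrable_bdd_mul hgc hM (hK.comp_sub_right t)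
  have h := hasSum_integral_of_summable_integral_norm (μ := volume)
    (F := fun (k : ℤ) y => boasCoeff k * (g y * K (y - τ k)))
    (fun k => (hi _).const_mul _) (by
      refine Summable.of_nonneg_of_le (fun k => integral_nonneg fun y => norm_nonneg _) (fun k => ?_)
        (summable_norm_boasCoeff.mul_right (M * ∫ y, ‖K y‖))
      simp_rw [norm_mul, integral_const_mul]
      refine mul_le_mul_of_nonneg_left ?_ (norm_nonneg _)
      rw [← integral_sub_right_eq_self (fun y => ‖K y‖) (τ k), ← integral_const_mul]
      refine integral_mono (by simpa only [norm_mul] using (hi _).norm)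
        ((hK.comp_sub_right _).norm.const_mul _) fun y => ?_
      exact mul_le_mul_of_nonneg_right (hM y) (norm_nonneg _))
  simpa only [integral_const_mul] using h

/-- The Boas formula, for spectra in the interior of the interval of linearity. -/
theorem HasSpectrumIn.hasDerivAt_of_lt {Ω W M : ℝ} {g : ℝ → ℂ} (hgc : Continuous g)
    (hM : ∀ s, ‖g s‖ ≤ M) (hg : HasSpectrumIn Ω g) (hΩ : 0 < Ω) (hW : Ω < W) (s : ℝ) :
    HasDerivAt g ((8 * W / Real.pi : ℝ) *
      ∑' k : ℤ, boasCoeff k * g (s + ((k : ℝ) - 1 / 2) / (2 * W))) s := by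
  have hW0 : 0 < W := hΩ.trans hW
  obtain ⟨K, hrep, hboas⟩ := hg.exists_kernel hgc hM hΩ hW
  have hd := hasDerivAt_integral_mul_schwartz_sub hgc hM K s
  have h := hasSum_integral_mul_translates hgc hM K.integrable
    fun k => s + ((k : ℝ) - 1 / 2) / (2 * W)
  simp_rw [hrep] at hd h
  rw [h.tsum_eq, ← integral_const_mul]
  convert hd using 1
  refine integral_congr_ae (ae_of_all _ fun y => ?_)
  have hs' : ∑' k : ℤ, boasCoeff k * (g y * K (y - (s + ((k : ℝ) - 1 / 2) / (2 * W)))) =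
      g y * (-(Real.pi / (8 * W)) * deriv K (y - s)) := by
    rw [← ((hboas (y - s)).mul_left (g y)).tsum_eq]
    refine tsum_congr fun k => ?_
    rw [mul_left_comm, sub_sub]
  have hW' : (W : ℂ) ≠ 0 := by exact_mod_cast hW0.ne'
  have hp : (Real.pi : ℂ) ≠ 0 := by exact_mod_cast Real.pi_ne_zero
  simp only [hs']
  push_cast
  field_simp

/-- The Boas formula for bounded functions with spectrum in `[-Ω, Ω]`. -/
theorem HasSpectrumIn.hasDerivAt {Ω M : ℝ} {g : ℝ → ℂ} (hgc : Continuous g)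
    (hM : ∀ s, ‖g s‖ ≤ M) (hg : HasSpectrumIn Ω g) (hΩ : 0 < Ω) (s : ℝ) :
    HasDerivAt g ((8 * Ω / Real.pi : ℝ) *
      ∑' k : ℤ, boasCoeff k * g (s + ((k : ℝ) - 1 / 2) / (2 * Ω))) s := by
  have hlt := fun W (hW : Ω < W) => hg.hasDerivAt_of_lt hgc hM hΩ hW s
  have hlim : Tendsto (fun W : ℝ => ((8 * W / Real.pi : ℝ) : ℂ) *
      ∑' k : ℤ, boasCoeff k * g (s + ((k : ℝ) - 1 / 2) / (2 * W))) (𝓝[>] Ω)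
      (𝓝 ((8 * Ω / Real.pi : ℝ) *
        ∑' k : ℤ, boasCoeff k * g (s + ((k : ℝ) - 1 / 2) / (2 * Ω)))) := by
    refine tendsto_nhdsWithin_of_tendsto_nhds (Tendsto.mul ?_ ?_)
    · exact (Complex.continuous_ofReal.tendsto _).comp
        (Continuous.tendsto (by fun_prop : Continuous fun W : ℝ => 8 * W / Real.pi) Ω)
    · refine tendsto_tsum_of_dominated_convergence (summable_norm_boasCoeff.mul_right M)
        (fun k => ?_) (Eventually.of_forall fun W k => ?_)
      · refine Tendsto.const_mul _ ((hgc.tendsto _).comp (Tendsto.const_add _ ?_))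
        exact tendsto_const_nhds.div (tendsto_id.const_mul 2) (by positivity)
      · rw [norm_mul]
        exact mul_le_mul_of_nonneg_left (hM _) (norm_nonneg _)
  -- For every `W > Ω` the right-hand side equals the same number `deriv g s`, so its limit at `Ω`
  -- does too.
  have hc : Tendsto (fun _ : ℝ => deriv g s) (𝓝[>] Ω) (𝓝 ((8 * Ω / Real.pi : ℝ) *
        ∑' k : ℤ, boasCoeff k * g (s + ((k : ℝ) - 1 / 2) / (2 * Ω)))) := by
    refine hlim.congr' ?_
    filter_upwards [self_mem_nhdsWithin] with W hW
    exact (hlt W hW).deriv.symm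
  rw [← tendsto_nhds_unique tendsto_const_nhds hc]
  exact (hlt (Ω + 1) (by linarith)).differentiableAt.hasDerivAt

end BandLimited

/-! ### The invariant measure and an infinite Minkowski inequality -/

theorem measurePreserving_exp_mellinMeasure :
    MeasurePreserving Real.exp volume mellinMeasure := by
  refine ⟨Real.measurable_exp, ?_⟩
  ext s hs
  have him : Real.exp '' (Real.exp ⁻¹' s) = s ∩ Ioi 0 := by
    rw [image_preimage_eq_inter_range, Real.range_exp]
  rw [Measure.map_apply Real.measurable_exp hs, mellinMeasure, withDensity_apply _ hs,
    Measure.restrict_restrict hs, ← him, lintegral_image_eq_lintegral_abs_deriv_mul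
      (Real.measurable_exp hs) (fun x _ => (Real.hasDerivAt_exp x).hasDerivWithinAt)
      Real.exp_injective.injOn]
  have : ∀ x : ℝ, ENNReal.ofReal |Real.exp x| * ENNReal.ofReal (Real.exp x)⁻¹ = 1 := by
    intro x
    rw [abs_of_pos (Real.exp_pos x), ← ENNReal.ofReal_mul (Real.exp_pos x).le,
      mul_inv_cancel₀ (Real.exp_pos x).ne', ENNReal.ofReal_one]
  simp_rw [this]
  simp

/-- Conjugation by `exp` turns the dilation into a translation of Lebesgue measure. -/
theorem measurePreserving_mul_exp_mellinMeasure (t : ℝ) :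
    MeasurePreserving (fun x => x * Real.exp t) mellinMeasure mellinMeasure := by
  refine ⟨by fun_prop, ?_⟩
  rw [← measurePreserving_exp_mellinMeasure.map_eq,
    Measure.map_map (by fun_prop) Real.measurable_exp]
  conv_rhs => rw [← map_add_right_eq_self (volume : Measure ℝ) t]
  rw [Measure.map_map Real.measurable_exp (by fun_prop)]
  congr 1
  ext x
  simp [Real.exp_add]

theorem mellinMeasure_absolutelyContinuous :
    mellinMeasure ≪ volume.restrict (Ioi (0 : ℝ)) :=
  withDensity_absolutelyContinuous _ _

theorem ae_mellinMeasure_pos : ∀ᵐ x ∂mellinMeasure, 0 < x :=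
  mellinMeasure_absolutelyContinuous.ae_le (ae_restrict_mem measurableSet_Ioi)

theorem eLpNorm_const_mul_complex {α : Type*} [MeasurableSpace α] {μ : Measure α} {p : ℝ≥0∞}
    (a : ℂ) (F : α → ℂ) : eLpNorm (fun x => a * F x) p μ = ‖a‖ₑ * eLpNorm F p μ :=
  eLpNorm_const_smul a F p μ

/-- Minkowski's inequality for partial sums, then Fatou's lemma. -/
theorem eLpNorm_le_tsum_of_hasSum {α : Type*} [MeasurableSpace α] {μ : Measure α} {p : ℝ≥0∞}
    (hp : 1 ≤ p) {u : ℤ → α → ℂ} {v : α → ℂ} (hu : ∀ k, AEStronglyMeasurable (u k) μ)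
    (h : ∀ᵐ x ∂μ, HasSum (fun k => u k x) (v x)) :
    eLpNorm v p μ ≤ ∑' k, eLpNorm (u k) p μ := by
  let e : ℕ ≃ ℤ := Equiv.intEquivNat.symm
  have hle : ∀ n : ℕ, eLpNorm (∑ i ∈ Finset.range n, u (e i)) p μ ≤ ∑' k, eLpNorm (u k) p μ := by
    intro n
    refine (eLpNorm_sum_le (fun i _ => hu (e i)) hp).trans ?_
    rw [← e.tsum_eq (fun k => eLpNorm (u k) p μ)]
    exact ENNReal.sum_le_tsum _
  refine (Lp.eLpNorm_lim_le_liminf_eLpNorm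
    (f := fun n => ∑ i ∈ Finset.range n, u (e i))
    (fun n => Finset.aestronglyMeasurable_sum _ fun i _ => hu (e i)) v ?_).trans ?_
  · filter_upwards [h] with x hx
    simpa using ((e.hasSum_iff).2 hx).tendsto_sum_nat
  · exact (liminf_le_liminf (Eventually.of_forall hle)).trans (liminf_const _).le

/-! ### Passage to the logarithmic variable -/

/-- The weighted function `x ^ c * f x` in the logarithmic variable `x = exp (2 π s)`. -/
noncomputable def mellinPullback (c : ℝ) (f : ℝ → ℂ) (s : ℝ) : ℂ :=
  ((Real.exp (2 * Real.pi * s) ^ c : ℝ) : ℂ) * f (Real.exp (2 * Real.pi * s))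

theorem continuous_mellinPullback {c : ℝ} {f : ℝ → ℂ} (hf : ContinuousOn f (Ioi 0)) :
    Continuous (mellinPullback c f) := by
  have he : Continuous fun s : ℝ => Real.exp (2 * Real.pi * s) := by fun_prop
  refine (Complex.continuous_ofReal.comp
    (he.rpow_const fun s => Or.inl (Real.exp_pos _).ne')).mul ?_
  exact hf.comp_continuous he fun s => Real.exp_pos _

theorem enorm_le_mellinNorm_top (c : ℝ) (f : ℝ → ℂ) {x : ℝ} (hx : 0 < x) :
    ‖((x ^ c : ℝ) : ℂ) * f x‖ₑ ≤ mellinNorm c ∞ f := by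
  rw [mellinNorm, if_pos rfl]
  exact le_iSup₂ (f := fun (x : ℝ) (_ : x ∈ Ioi (0 : ℝ)) => ‖((x ^ c : ℝ) : ℂ) * f x‖ₑ) x hx

theorem norm_mellinPullback_le {c : ℝ} {f : ℝ → ℂ} (hf : mellinNorm c ∞ f < ∞) (s : ℝ) :
    ‖mellinPullback c f s‖ ≤ (mellinNorm c ∞ f).toReal := by
  rw [← toReal_enorm]
  exact ENNReal.toReal_mono hf.ne (enorm_le_mellinNorm_top c f (Real.exp_pos _))

theorem integral_Ioi_eq_integral_exp (H : ℝ → ℂ) :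
    ∫ u in Ioi (0 : ℝ), H u = ∫ s : ℝ, ((2 * Real.pi * Real.exp (2 * Real.pi * s) : ℝ) : ℂ) *
      H (Real.exp (2 * Real.pi * s)) := by
  have hpi : 0 < 2 * Real.pi := by positivity
  have him : (fun s : ℝ => Real.exp (2 * Real.pi * s)) '' univ = Ioi 0 := by
    ext x
    simp only [image_univ, mem_range, mem_Ioi]
    refine ⟨fun ⟨y, hy⟩ => hy ▸ Real.exp_pos _, fun hx => ⟨Real.log x / (2 * Real.pi), ?_⟩⟩
    rw [mul_div_cancel₀ _ hpi.ne', Real.exp_log hx]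
  rw [← him, integral_image_eq_integral_abs_deriv_smul MeasurableSet.univ
    (f' := fun s => 2 * Real.pi * Real.exp (2 * Real.pi * s)), setIntegral_univ]
  · refine integral_congr_ae (ae_of_all _ fun s => ?_)
    simp only
    rw [abs_of_pos (by positivity), Complex.real_smul]
  · intro s _
    have h := ((hasDerivAt_id s).const_mul (2 * Real.pi)).exp
    simp only [id, mul_one] at h
    rw [mul_comm (2 * Real.pi) (Real.exp _)]
    exact h.hasDerivWithinAt
  · intro a _ b _ hab
    exact mul_left_cancel₀ hpi.ne' (Real.exp_injective hab)

/-- With `u = exp (2πs)` one has `u ^ (it) = exp (2πist)` and `du / u = 2π ds`; the scale `2π` makes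
the two frequency variables coincide. -/
theorem IsMellinBandLimited.hasSpectrumIn {c σ : ℝ} {f : ℝ → ℂ} (hf : IsMellinBandLimited c σ f) :
    HasSpectrumIn σ (mellinPullback c f) := by
  intro φ hφ hφc hφs
  have h := hf φ hφ hφc hφs
  have e : ∀ s : ℝ, ((2 * Real.pi * Real.exp (2 * Real.pi * s) : ℝ) : ℂ) *
      (f (Real.exp (2 * Real.pi * s)) * ((Real.exp (2 * Real.pi * s) ^ (c - 1) : ℝ) : ℂ) *
        ∫ t : ℝ, φ t * ((Real.exp (2 * Real.pi * s) : ℝ) : ℂ) ^ ((t : ℂ) * Complex.I)) =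
      ((2 * Real.pi : ℝ) : ℂ) * (mellinPullback c f s *
        ∫ t : ℝ, φ t * Complex.exp (2 * Real.pi * Complex.I * s * t)) := by
    intro s
    have h1 : ∀ t : ℝ, ((Real.exp (2 * Real.pi * s) : ℝ) : ℂ) ^ ((t : ℂ) * Complex.I) =
        Complex.exp (2 * Real.pi * Complex.I * s * t) := by
      intro t
      rw [Complex.cpow_def_of_ne_zero (by exact_mod_cast (Real.exp_pos _).ne'),
        ← Complex.ofReal_log (Real.exp_pos _).le, Real.log_exp]
      congr 1
      push_cast
      ring
    have h2 : Real.exp (2 * Real.pi * s) ^ c =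
        Real.exp (2 * Real.pi * s) ^ (c - 1) * Real.exp (2 * Real.pi * s) := by
      rw [← Real.rpow_add_one (Real.exp_pos _).ne', sub_add_cancel]
    simp_rw [h1]
    rw [mellinPullback, h2, Complex.ofReal_mul (2 * Real.pi),
      Complex.ofReal_mul (Real.exp (2 * Real.pi * s) ^ (c - 1))]
    ring
  rw [integral_Ioi_eq_integral_exp] at h
  simp_rw [e] at h
  rw [integral_const_mul] at h
  refine (mul_eq_zero.1 h).resolve_left ?_
  exact_mod_cast (by positivity : (2 * Real.pi) ≠ 0)

theorem mellinPullback_log_div {c x : ℝ} {f : ℝ → ℂ} (hx : 0 < x) (t : ℝ) :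
    mellinPullback c f (Real.log x / (2 * Real.pi) + t / (2 * Real.pi)) =
      (((x * Real.exp t) ^ c : ℝ) : ℂ) * f (x * Real.exp t) := by
  rw [mellinPullback, mul_add, mul_div_cancel₀ _ (by positivity), mul_div_cancel₀ _ (by positivity),
    Real.exp_add, Real.exp_log hx]

theorem rpow_mul_mellinBoasTerm {c T x : ℝ} {f : ℝ → ℂ} (hx : 0 < x) (k : ℤ) :
    ((x ^ c : ℝ) : ℂ) * mellinBoasTerm c T f x k =
      boasCoeff k * ((((x * Real.exp (((k : ℝ) - 1 / 2) / T)) ^ c : ℝ) : ℂ) *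
        f (x * Real.exp (((k : ℝ) - 1 / 2) / T))) := by
  rw [mellinBoasTerm, Real.mul_rpow hx.le (Real.exp_pos _).le, ← Real.exp_mul, boasCoeff,
    Complex.ofReal_mul, show ((k : ℝ) - 1 / 2) / T * c = ((k : ℝ) - 1 / 2) * c / T by ring]
  ring

theorem boasCoeff_mul_mellinPullback {c T x : ℝ} {f : ℝ → ℂ} (hT : 0 < T) (hx : 0 < x) (k : ℤ) :
    boasCoeff k * mellinPullback c f
      (Real.log x / (2 * Real.pi) + ((k : ℝ) - 1 / 2) / (2 * (Real.pi * T))) =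
      ((x ^ c : ℝ) : ℂ) * mellinBoasTerm c T f x k := by
  rw [rpow_mul_mellinBoasTerm hx, ← mellinPullback_log_div hx]
  congr 3
  field_simp

/-! ### The series for the Mellin derivative and the norm bound -/

theorem summable_mellinBoasTerm {c T x : ℝ} {f : ℝ → ℂ} (hT : 0 < T)
    (hf : mellinNorm c ∞ f < ∞) (hx : 0 < x) : Summable (mellinBoasTerm c T f x) := by
  have hxc : ((x ^ c : ℝ) : ℂ) ≠ 0 := by exact_mod_cast (Real.rpow_pos_of_pos hx c).ne'
  rw [← summable_mul_left_iff hxc]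
  simp_rw [← boasCoeff_mul_mellinPullback hT hx]
  exact summable_boasCoeff_mul fun k => norm_mellinPullback_le hf _

theorem hasMellinDerivAt_boas {c T : ℝ} (hT : 0 < T) {f : ℝ → ℂ}
    (hf : f ∈ MellinBernstein c ∞ (Real.pi * T)) {x : ℝ} (hx : 0 < x) :
    HasMellinDerivAt c f (((4 * T / Real.pi : ℝ) : ℂ) * ∑' k : ℤ, mellinBoasTerm c T f x k) x := by
  obtain ⟨hfc, hfn, hfb⟩ := hf
  have hxc : ((x ^ c : ℝ) : ℂ) ≠ 0 := by exact_mod_cast (Real.rpow_pos_of_pos hx c).ne'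
  have hg := hfb.hasSpectrumIn.hasDerivAt (continuous_mellinPullback hfc)
    (norm_mellinPullback_le hfn) (by positivity) (Real.log x / (2 * Real.pi))
  simp_rw [boasCoeff_mul_mellinPullback hT hx] at hg
  rw [tsum_mul_left] at hg
  have hl : HasDerivAt (fun h : ℝ => Real.log x / (2 * Real.pi) + Real.log h / (2 * Real.pi))
      (1 / (2 * Real.pi)) 1 := by
    simpa using ((Real.hasDerivAt_log one_ne_zero).div_const (2 * Real.pi)).const_add
      (Real.log x / (2 * Real.pi))
  have hc := (HasDerivAt.scomp (h := fun h : ℝ => Real.log x / (2 * Real.pi) +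
    Real.log h / (2 * Real.pi)) (1 : ℝ) (by simpa using hg) hl).const_mul ((x ^ c : ℝ) : ℂ)⁻¹
  -- The Mellin quotient is the slope at `1` of this function. The chain rule factor `1 / (2π)`
  -- turns `8Ω/π = 8T` into `4T/π`.
  have hG : HasDerivAt (fun h : ℝ => ((h ^ c : ℝ) : ℂ) * f (h * x))
      (((4 * T / Real.pi : ℝ) : ℂ) * ∑' k : ℤ, mellinBoasTerm c T f x k) 1 := by
    convert! hc.congr_of_eventuallyEq ?_ using 1
    · rw [Complex.real_smul]
      push_cast
      have hp : (Real.pi : ℂ) ≠ 0 := by exact_mod_cast Real.pi_ne_zero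
      field_simp
      ring
    · filter_upwards [lt_mem_nhds one_pos] with h hh
      simp only [Function.comp_apply]
      rw [mellinPullback_log_div hx, Real.exp_log hh, mul_comm x h, Real.mul_rpow hh.le hx.le,
        Complex.ofReal_mul]
      field_simp
  rw [hasDerivAt_iff_tendsto_slope] at hG
  refine hG.congr fun h => ?_
  rw [slope_def_module, mellinQuotient, Complex.real_smul]
  push_cast
  rw [Real.one_rpow, one_mul, Complex.ofReal_one, one_mul, div_eq_inv_mul]

theorem mellinDeriv_eq_boas {c T : ℝ} (hT : 0 < T) {f : ℝ → ℂ}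
    (hf : f ∈ MellinBernstein c ∞ (Real.pi * T)) {x : ℝ} (hx : 0 < x) :
    mellinDeriv c f x = ((4 * T / Real.pi : ℝ) : ℂ) * ∑' k : ℤ, mellinBoasTerm c T f x k :=
  Tendsto.limUnder_eq (hasMellinDerivAt_boas hT hf hx)

theorem hasSum_rpow_mul_mellinDeriv {c T : ℝ} (hT : 0 < T) {f : ℝ → ℂ}
    (hf : f ∈ MellinBernstein c ∞ (Real.pi * T)) {x : ℝ} (hx : 0 < x) :
    HasSum (fun k : ℤ => ((4 * T / Real.pi : ℝ) : ℂ) * boasCoeff k *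
      ((((x * Real.exp (((k : ℝ) - 1 / 2) / T)) ^ c : ℝ) : ℂ) *
        f (x * Real.exp (((k : ℝ) - 1 / 2) / T)))) (((x ^ c : ℝ) : ℂ) * mellinDeriv c f x) := by
  rw [mellinDeriv_eq_boas hT hf hx, mul_left_comm]
  simp_rw [mul_assoc, ← rpow_mul_mellinBoasTerm hx]
  exact ((summable_mellinBoasTerm hT hf.2.1 hx).hasSum.mul_left _).mul_left _

theorem tsum_enorm_boasCoeff {T : ℝ} (hT : 0 < T) :
    ∑' k : ℤ, ‖((4 * T / Real.pi : ℝ) : ℂ) * boasCoeff k‖ₑ = ENNReal.ofReal (Real.pi * T) := by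
  have h := hasSum_norm_boasCoeff.mul_left (4 * T / Real.pi)
  have e : 4 * T / Real.pi * (Real.pi ^ 2 / 4) = Real.pi * T := by field_simp
  rw [← e, ← h.tsum_eq, ENNReal.ofReal_tsum_of_nonneg (fun k => by positivity) h.summable]
  refine tsum_congr fun k => ?_
  rw [← ofReal_norm, norm_mul, Complex.norm_real, Real.norm_of_nonneg (by positivity)]

theorem mellinNorm_mellinDeriv_le {c T : ℝ} (hT : 0 < T) {f : ℝ → ℂ}
    (hf : f ∈ MellinBernstein c ∞ (Real.pi * T)) {p : ℝ≥0∞} (hp : 1 ≤ p) :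
    mellinNorm c p (mellinDeriv c f) ≤ ENNReal.ofReal (Real.pi * T) * mellinNorm c p f := by
  have hs := fun (x : ℝ) (hx : 0 < x) => hasSum_rpow_mul_mellinDeriv hT hf hx
  rw [← tsum_enorm_boasCoeff hT, ← ENNReal.tsum_mul_right]
  -- For `p = ∞` the norm is a true supremum rather than an essential one, so the bound is
  -- pointwise.
  by_cases hpt : p = ∞
  · subst hpt
    conv_lhs => rw [mellinNorm, if_pos rfl]
    refine iSup₂_le fun x (hx : 0 < x) => ?_
    rw [← (hs x hx).tsum_eq]
    refine enorm_tsum_le_tsum_enorm.trans (ENNReal.tsum_le_tsum fun k => ?_)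
    rw [enorm_mul]
    gcongr
    exact enorm_le_mellinNorm_top c f (mul_pos hx (Real.exp_pos _))
  · have hm : AEStronglyMeasurable (fun x : ℝ => ((x ^ c : ℝ) : ℂ) * f x) mellinMeasure := by
      refine AEStronglyMeasurable.mono_ac mellinMeasure_absolutelyContinuous
        (ContinuousOn.aestronglyMeasurable (ContinuousOn.mul ?_ hf.1) measurableSet_Ioi)
      exact Complex.continuous_ofReal.comp_continuousOn
        (continuousOn_id.rpow_const fun x (hx : 0 < x) => Or.inl hx.ne')
    rw [mellinNorm, if_neg hpt, mellinNorm, if_neg hpt]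
    have hmp := fun k : ℤ => measurePreserving_mul_exp_mellinMeasure (((k : ℝ) - 1 / 2) / T)
    refine (eLpNorm_le_tsum_of_hasSum hp
      (fun k => (hm.comp_measurePreserving (hmp k)).const_mul
        (((4 * T / Real.pi : ℝ) : ℂ) * boasCoeff k))
      (ae_mellinMeasure_pos.mono hs)).trans (ENNReal.tsum_le_tsum fun k => ?_)
    rw [← eLpNorm_comp_measurePreserving hm (hmp k)]
    exact (eLpNorm_const_mul_complex _ _).le

theorem theorem9 (c T : ℝ) (hT : 0 < T) (f : ℝ → ℂ)
    (hf : f ∈ MellinBernstein c ∞ (Real.pi * T)) :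
    (∀ x : ℝ, 0 < x →
      HasMellinDerivAt c f (mellinDeriv c f x) x ∧
      Summable (mellinBoasTerm c T f x) ∧
      mellinDeriv c f x = ((4 * T / Real.pi : ℝ) : ℂ) * ∑' k : ℤ, mellinBoasTerm c T f x k) ∧
    (∀ p : ℝ≥0∞, 1 ≤ p →
      mellinNorm c p (mellinDeriv c f) ≤ ENNReal.ofReal (Real.pi * T) * mellinNorm c p f) := by
  refine ⟨fun x hx => ⟨?_, summable_mellinBoasTerm hT hf.2.1 hx, mellinDeriv_eq_boas hT hf hx⟩,
    fun p hp => mellinNorm_mellinDeriv_le hT hf hp⟩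
  rw [mellinDeriv_eq_boas hT hf hx]
  exact hasMellinDerivAt_boas hT hf hx
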